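/- Let $p$ be a prime and $k$ a field of characteristic $p$. Let $A = k[x]$ and $B = A/(x) = k$, i.e. $B = k$ viewed as an $A$-algebra through the ring homomorphism $A \to k$ with $x \mapsto 0$. Let $\mathrm{T}^p_A(B)$ be the $p$-fold tensor power of $B$ over $A$, let $\mathrm{TS}^p_A(B) = \mathrm{T}^p_A(B)^{\mathfrak{S}_p}$ be the module of symmetric tensors, and let $\Gamma^p_A(B)$ be the degree $p$ part of the divided power algebra of the $A$-module $B$, with canonical map $\gamma^p : B \to \Gamma^p_A(B)$. Let $\Gamma^p_A(B) \to \mathrm{TS}^p_A(B)$ be the canonical $A$-linear map: it corresponds to the polynomial law $b \mapsto b^{\otimes p}$, i.e. it sends $\gamma^{\nu_1}(b_1) \times \cdots \times \gamma^{\nu_r}(b_r)$ with $\nu_1 + \cdots + \nu_r = p$ to the sum of all tensors in $\mathrm{T}^p_A(B)$ whose factors are $b_1, \ldots, b_r$, with $b_j$ placed in exactly $\nu_j$ of the $p$ positions. Then 1. there is an isomorphism of $A$-modules $\Gamma^p_A(B) \cong k[x]/(x^p)$ which maps $\gamma^p(1)$ to $1$; 2. there is an isomorphism of $A$-modules $\mathrm{T}^p_A(B)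 \cong k$ which maps $1 \otimes \cdots \otimes 1$ to $1$; 3. there is an isomorphism of $A$-modules $\mathrm{TS}^p_A(B) \cong k$ which maps $1 \otimes \cdots \otimes 1$ to $1$; 4. the canonical map $\Gamma^p_A(B) \to \mathrm{TS}^p_A(B)$ is not injective. -/

import Mathlib

open scoped TensorProduct

/-- The module `TS^n_A(M)` of symmetric tensors: the tensors in `T^n_A(M) = M ⊗ ⋯ ⊗ M` fixed by the
action `σ (m₁ ⊗ ⋯ ⊗ mₙ) = m_{σ⁻¹ 1} ⊗ ⋯ ⊗ m_{σ⁻¹ n}` of the symmetric group. -/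
def symmetricTensors (A : Type*) [CommRing A] (M : Type*) [AddCommGroup M] [Module A M] (n : ℕ) :
    Submodule A (⨂[A] (_ : Fin n), M) where
  carrier := {t | ∀ σ : Equiv.Perm (Fin n), PiTensorProduct.reindex A (fun _ => M) σ t = t}
  add_mem' := fun ha hb σ => (map_add _ _ _).trans (congrArg₂ _ (ha σ) (hb σ))
  zero_mem' := fun σ => map_zero (PiTensorProduct.reindex A (fun _ => M) σ)
  smul_mem' := fun _ _ ha σ => (map_smul _ _ _).trans (congrArg _ (ha σ))

/-- The degree `n` part `Γ^n_A(M)` of the divided power algebra `Γ_A(M)`: it is spanned by the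
products `γ^{ν₁}(x₁) × ⋯ × γ^{νᵣ}(xᵣ)` with `ν₁ + ⋯ + νᵣ = n`. -/
noncomputable def dividedPower (A : Type*) [CommRing A] (M : Type*) [AddCommGroup M] [Module A M] (n : ℕ) :
    Submodule A (DividedPowerAlgebra A M) :=
  Submodule.span A {y | ∃ (r : ℕ) (ν : Fin r → ℕ) (x : Fin r → M),
    ∑ j, ν j = n ∧ y = ∏ j, DividedPowerAlgebra.dp A (ν j) (x j)}

/-- The element `γ^n(x)` of `Γ^n_A(M)`. -/
noncomputable def dividedPower.gamma (A : Type*) [CommRing A] {M : Type*} [AddCommGroup M] [Module A M] (n : ℕ)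
    (x : M) : dividedPower A M n :=
  ⟨DividedPowerAlgebra.dp A n x, Submodule.subset_span ⟨1, fun _ => n, fun _ => x, by simp⟩⟩

/-- The element `x ⊗ ⋯ ⊗ x` of `TS^n_A(M)`. -/
noncomputable def symmetricTensors.pow (A : Type*) [CommRing A] {M : Type*} [AddCommGroup M]
    [Module A M] (n : ℕ) (x : M) : symmetricTensors A M n :=
  ⟨PiTensorProduct.tprod A fun _ => x, fun σ => PiTensorProduct.reindex_tprod σ _⟩

namespace GammaToTS

section

/-- The right action of a commutative ring on a module, equal to the left one. -/
abbrev opModule (A : Type*) [CommRing A] (M : Type*) [AddCommGroup M] [Module A M] :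
    Module Aᵐᵒᵖ M :=
  Module.compHom M ((RingHom.id A).fromOpposite fun _ _ => mul_comm _ _)

attribute [local instance] opModule

/-- The two actions agree. -/
theorem opModule_central (A : Type*) [CommRing A] (M : Type*) [AddCommGroup M] [Module A M] :
    IsCentralScalar A M := ⟨fun _ _ => rfl⟩

attribute [local instance] opModule_central

variable (A : Type*) [CommRing A] {M : Type*} [AddCommGroup M] [Module A M] (n : ℕ)

/-- For `m : M` put in the `i`-th factor: the element `1 ⊗ ⋯ ⊗ m ⊗ ⋯ ⊗ 1` of the `n`-fold tensor
product of the square-zero extension `A ⊕ M`. -/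
noncomputable def slot (i : Fin n) (m : M) : ⨂[A] (_ : Fin n), TrivSqZeroExt A M :=
  PiTensorProduct.singleAlgHom i (TrivSqZeroExt.inr m)

/-- The `j`-th elementary symmetric polynomial in the elements `slot A n i m`. -/
noncomputable def elem (j : ℕ) (m : M) : ⨂[A] (_ : Fin n), TrivSqZeroExt A M :=
  ∑ s ∈ Finset.powersetCard j Finset.univ, ∏ i ∈ s, slot A n i m

theorem slot_mul (i : Fin n) (u v : M) : slot A n i u * slot A n i v = 0 := by
  rw [slot, slot, ← map_mul, TrivSqZeroExt.inr_mul_inr, map_zero]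

theorem slot_add (i : Fin n) (u v : M) : slot A n i (u + v) = slot A n i u + slot A n i v := by
  rw [slot, TrivSqZeroExt.inr_add, map_add]; rfl

theorem slot_smul (i : Fin n) (r : A) (u : M) : slot A n i (r • u) = r • slot A n i u := by
  rw [slot, TrivSqZeroExt.inr_smul, map_smul]; rfl

theorem prod_smul_slot (s : Finset (Fin n)) (r : A) (m : M) :
    ∏ i ∈ s, r • slot A n i m = r ^ s.card • ∏ i ∈ s, slot A n i m := by
  have h (i : Fin n) : r • slot A n i m = algebraMap A _ r * slot A n i m :=
    Algebra.smul_def (A := ⨂[A] (_ : Fin n), TrivSqZeroExt A M) r _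
  simp only [h, Finset.prod_mul_distrib, Finset.prod_const, ← map_pow]
  exact (Algebra.smul_def (A := ⨂[A] (_ : Fin n), TrivSqZeroExt A M) _ _).symm

open Polynomial in
theorem coeff_prod_eq {R ι : Type*} [CommSemiring R] (a : ι → R) (s : Finset ι) (j : ℕ) :
    (∏ i ∈ s, (1 + C (a i) * X)).coeff j = ∑ t ∈ Finset.powersetCard j s, ∏ i ∈ t, a i := by
  classical
  rw [Finset.prod_one_add, Polynomial.finsetSum_coeff]
  simp_rw [Finset.prod_mul_distrib, Finset.prod_const, ← map_prod, coeff_C_mul_X_pow]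
  rw [← Finset.sum_filter, Finset.powersetCard_eq_filter]
  simp_rw [eq_comm]

theorem elem_eq_coeff (j : ℕ) (m : M) : elem A n j m =
    (∏ i, (1 + Polynomial.C (slot A n i m) * Polynomial.X)).coeff j :=
  (coeff_prod_eq _ _ _).symm

theorem elem_zero (m : M) : elem A n 0 m = 1 := by simp [elem]

theorem elem_smul (j : ℕ) (r : A) (m : M) : elem A n j (r • m) = r ^ j • elem A n j m := by
  rw [elem, elem, Finset.smul_sum]
  refine Finset.sum_congr rfl fun s hs => ?_
  simp only [slot_smul]
  rw [prod_smul_slot, (Finset.mem_powersetCard.1 hs).2]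

open Polynomial in
theorem elem_add (j : ℕ) (u v : M) : elem A n j (u + v) =
    ∑ q ∈ Finset.HasAntidiagonal.antidiagonal j, elem A n q.1 u * elem A n q.2 v := by
  simp_rw [elem_eq_coeff]
  rw [← coeff_mul, ← Finset.prod_mul_distrib]
  congr 1
  refine Finset.prod_congr rfl fun i _ => ?_
  rw [slot_add, C_add]
  have h : C (slot A n i u) * C (slot A n i v) = 0 := by rw [← C_mul, slot_mul, C_0]
  have h2 : (1 + C (slot A n i u) * X) * (1 + C (slot A n i v) * X) =
      1 + (C (slot A n i u) + C (slot A n i v)) * X +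
        C (slot A n i u) * C (slot A n i v) * X ^ 2 := by ring
  rw [h2, h, zero_mul, add_zero]

open Polynomial in
theorem elem_mul (j l : ℕ) (m : M) :
    elem A n j m * elem A n l m = (j + l).choose j • elem A n (j + l) m := by
  simp_rw [elem_eq_coeff]
  generalize (Finset.univ : Finset (Fin n)) = s
  induction s using Finset.induction_on generalizing j l with
  | empty =>
    rcases j with _ | j
    · simp
    · simp [coeff_one]
  | insert i s hi ih =>
    rw [Finset.prod_insert hi]
    have h := slot_mul A n i m m
    set a := slot A n i m
    set P := ∏ i ∈ s, (1 + C (slot A n i m) * X)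
    have e0 : ((1 + C a * X) * P).coeff 0 = P.coeff 0 := by simp [add_mul, mul_assoc]
    have e1 (j : ℕ) : ((1 + C a * X) * P).coeff (j + 1) = P.coeff (j + 1) + a * P.coeff j := by
      simp [add_mul, mul_assoc]
    rcases j with _ | j
    · have := ih 0 l
      simp only [zero_add, Nat.choose_zero_right, one_smul] at this ⊢
      rw [e0]
      rcases l with _ | l
      · rw [e0, this]
      · have h2 := ih 0 l
        simp only [zero_add, Nat.choose_zero_right, one_smul] at h2
        rw [e1]
        linear_combination this + a * h2
    · rcases l with _ | l
      · have h1 := ih (j + 1) 0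
        have h2 := ih j 0
        simp only [add_zero, Nat.choose_self, one_smul] at h1 h2 ⊢
        rw [e0, e1]
        linear_combination h1 + a * h2
      · have h1 := ih (j + 1) (l + 1)
        have h2 := ih j (l + 1)
        have h3 := ih (j + 1) l
        rw [show j + 1 + (l + 1) = (j + l + 1) + 1 by ring] at h1 ⊢
        rw [show j + (l + 1) = j + l + 1 by ring] at h2
        rw [show j + 1 + l = j + l + 1 by ring] at h3
        rw [Nat.choose_succ_succ] at h1 ⊢
        rw [e1, e1, e1]
        simp only [nsmul_eq_mul, Nat.cast_add] at h1 h2 h3 ⊢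
        linear_combination h1 + a * h2 + a * h3 + P.coeff j * P.coeff l * h

/-- The algebra homomorphism from `Γ_A(M)` to the `n`-fold tensor product of `A ⊕ M` which sends
`γ^j(m)` to the `j`-th elementary symmetric polynomial in the `slot A n i m`. -/
noncomputable def toTensor (A : Type*) [CommRing A] (M : Type*) [AddCommGroup M] [Module A M]
    (n : ℕ) :
    DividedPowerAlgebra A M →ₐ[A] ⨂[A] (_ : Fin n), TrivSqZeroExt A M :=
  DividedPowerAlgebra.lift' (f := fun q => elem A n q.1 q.2) (elem_zero A n)
    (elem_smul A n) (elem_mul A n) (elem_add A n)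

/-- The projection of the `n`-fold tensor product of `A ⊕ M` onto its summand `T^n_A(M)`. -/
noncomputable def proj (A : Type*) [CommRing A] (M : Type*) [AddCommGroup M] [Module A M]
    (n : ℕ) : (⨂[A] (_ : Fin n), TrivSqZeroExt A M) →ₗ[A] ⨂[A] (_ : Fin n), M :=
  PiTensorProduct.map fun _ => TrivSqZeroExt.sndHom A M

/-- The action of a permutation, as an algebra homomorphism. -/
noncomputable def perm (A : Type*) [CommRing A] (M : Type*) [AddCommGroup M] [Module A M]
    (n : ℕ) (σ : Equiv.Perm (Fin n)) :
    (⨂[A] (_ : Fin n), TrivSqZeroExt A M) →ₐ[A] ⨂[A] (_ : Fin n), TrivSqZeroExt A M :=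
  PiTensorProduct.liftAlgHom
    ((PiTensorProduct.reindex A (fun _ => TrivSqZeroExt A M) σ).toLinearMap.compMultilinearMap
      (PiTensorProduct.tprod A))
    (PiTensorProduct.reindex_tprod σ _)
    (fun x y => by
      simp only [LinearMap.compMultilinearMap_apply, LinearEquiv.coe_coe,
        PiTensorProduct.reindex_tprod, PiTensorProduct.tprod_mul_tprod]
      rfl)

theorem perm_apply (σ : Equiv.Perm (Fin n)) (t : ⨂[A] (_ : Fin n), TrivSqZeroExt A M) :
    perm A M n σ t = PiTensorProduct.reindex A (fun _ => TrivSqZeroExt A M) σ t := by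
  have : (perm A M n σ).toLinearMap =
      (PiTensorProduct.reindex A (fun _ => TrivSqZeroExt A M) σ).toLinearMap := by
    ext x
    simp [perm]
  exact LinearMap.congr_fun this t

theorem perm_slot (σ : Equiv.Perm (Fin n)) (i : Fin n) (m : M) :
    perm A M n σ (slot A n i m) = slot A n (σ i) m := by
  rw [perm_apply]
  simp only [slot, PiTensorProduct.singleAlgHom_apply, PiTensorProduct.reindex_tprod]
  congr 1
  funext j
  simp only [MonoidHom.mulSingle_apply, Pi.mulSingle, Function.update_apply, Equiv.symm_apply_eq]
  rfl

open Polynomial in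
theorem perm_elem (σ : Equiv.Perm (Fin n)) (j : ℕ) (m : M) :
    perm A M n σ (elem A n j m) = elem A n j m := by
  simp_rw [elem_eq_coeff]
  have := coeff_map (p := ∏ i, (1 + C (slot A n i m) * X)) (perm A M n σ).toRingHom j
  simp only [AlgHom.toRingHom_eq_coe, RingHom.coe_coe] at this
  rw [← this, Polynomial.map_prod]
  simp only [Polynomial.map_add, Polynomial.map_one, Polynomial.map_mul, map_C, map_X,
    RingHom.coe_coe, perm_slot]
  rw [Equiv.prod_comp σ fun i => 1 + C (slot A n i m) * X]

theorem perm_toTensor (σ : Equiv.Perm (Fin n)) (y : DividedPowerAlgebra A M) :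
    perm A M n σ (toTensor A M n y) = toTensor A M n y := by
  have : (perm A M n σ).comp (toTensor A M n) = toTensor A M n := by
    refine DividedPowerAlgebra.algHom_ext fun j m => ?_
    simp [toTensor, perm_elem]
  exact AlgHom.congr_fun this y

theorem proj_toTensor_mem (y : DividedPowerAlgebra A M) :
    proj A M n (toTensor A M n y) ∈ symmetricTensors A M n := fun σ => by
  rw [proj]
  refine (PiTensorProduct.map_reindex (fun _ => TrivSqZeroExt.sndHom A M) σ _).symm.trans ?_
  rw [← perm_apply, perm_toTensor]

/-- The canonical map `Γ^n_A(M) → TS^n_A(M)`, the linear map which corresponds to the polynomial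
law `x ↦ x ⊗ ⋯ ⊗ x`. It sends `γ^{ν₁}(x₁) × ⋯ × γ^{νᵣ}(xᵣ)` to the shuffle product of the
`xⱼ ⊗ ⋯ ⊗ xⱼ` (`νⱼ` factors), see `canonicalMap_prod`. -/
noncomputable def canonicalMap (A : Type*) [CommRing A] (M : Type*) [AddCommGroup M] [Module A M]
    (n : ℕ) : dividedPower A M n →ₗ[A] symmetricTensors A M n :=
  ((proj A M n ∘ₗ (toTensor A M n).toLinearMap).codRestrict _
    (proj_toTensor_mem A n)).domRestrict _

/-- The value of the canonical map at a product of divided powers: the sum of all tensors in which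
`xⱼ` occurs exactly `νⱼ` times, for all `j`. -/
theorem canonicalMap_prod (r : ℕ) (ν : Fin r → ℕ) (x : Fin r → M)
    (h : ∏ j, DividedPowerAlgebra.dp A (ν j) (x j) ∈ dividedPower A M n) :
    (canonicalMap A M n ⟨_, h⟩ : ⨂[A] (_ : Fin n), M) =
      ∑ f : Fin n → Fin r with ∀ j, Finset.card {i | f i = j} = ν j,
        PiTensorProduct.tprod A fun i => x (f i) := by
  have hs (i : Fin n) (m : M) : slot A n i m =
      PiTensorProduct.tprod A (Pi.mulSingle i (TrivSqZeroExt.inr m : TrivSqZeroExt A M)) := rfl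
  have key (S : Fin r → Finset (Fin n)) : proj A M n (∏ j, ∏ i ∈ S j, slot A n i (x j)) =
      PiTensorProduct.tprod A fun i =>
        TrivSqZeroExt.snd (∏ j with i ∈ S j, (TrivSqZeroExt.inr (x j) : TrivSqZeroExt A M)) := by
    simp_rw [hs, ← PiTensorProduct.tprod_prod]
    rw [proj, PiTensorProduct.map_tprod]
    congr 1
    funext i
    simp only [TrivSqZeroExt.sndHom_apply, Finset.prod_apply, Finset.prod_pi_mulSingle]
    rw [Finset.prod_filter]
  have hsnd (T : Finset (Fin r)) (hT : T.card ≠ 1) :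
      TrivSqZeroExt.snd (∏ j ∈ T, (TrivSqZeroExt.inr (x j) : TrivSqZeroExt A M)) = 0 := by
    rcases Nat.lt_or_gt_of_ne hT with hT | hT
    · obtain rfl : T = ∅ := by rw [← Finset.card_eq_zero]; omega
      simp
    · obtain ⟨a, ha, b, hb, hab⟩ := Finset.one_lt_card.1 hT
      rw [← Finset.mul_prod_erase T _ ha,
        ← Finset.mul_prod_erase (T.erase a) _ (Finset.mem_erase.2 ⟨hab.symm, hb⟩), ← mul_assoc,
        TrivSqZeroExt.inr_mul_inr, zero_mul, TrivSqZeroExt.snd_zero]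
  change proj A M n (toTensor A M n (∏ j, DividedPowerAlgebra.dp A (ν j) (x j))) = _
  rw [map_prod]
  simp only [toTensor, DividedPowerAlgebra.lift'_apply_dp, elem]
  rw [Finset.prod_univ_sum, map_sum]
  simp_rw [key]
  symm
  refine Finset.sum_of_injOn (fun f j => Finset.univ.filter fun i => f i = j) ?_ ?_ ?_ ?_
  · intro f _ g _ hfg
    funext i
    have := congrFun hfg (g i)
    have h2 : i ∈ Finset.univ.filter fun a => f a = g i := by
      simp only at this; rw [this]; simp
    simpa using h2
  · intro f hf
    simpa [Fintype.mem_piFinset, Finset.mem_powersetCard] using hf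
  · intro S hS hS'
    by_cases hc : ∀ i, Finset.card {j | i ∈ S j} = 1
    · exfalso
      apply hS'
      choose f hf using fun i => Finset.card_eq_one.1 (hc i)
      have hf' (i j) : i ∈ S j ↔ f i = j := by
        have := Finset.ext_iff.1 (hf i) j
        simpa [eq_comm] using this
      have hfS : (fun j => Finset.univ.filter fun i => f i = j) = S := by
        funext j; ext i; simp [hf']
      refine ⟨f, ?_, hfS⟩
      have : ∀ j, Finset.univ.filter (fun i => f i = j) = S j := congrFun hfS
      simp only [Finset.coe_filter, Finset.mem_univ, true_and, Set.mem_ofPred_eq, this]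
      intro j
      exact (Finset.mem_powersetCard.1 (Fintype.mem_piFinset.1 hS j)).2
    · push Not at hc
      obtain ⟨i, hi⟩ := hc
      exact MultilinearMap.map_coord_zero _ i (hsnd _ hi)
  · intro f _
    congr 1
    funext i
    simp [Finset.filter_eq]

end

end GammaToTS

/-!
Write `A = k[x]`, so that `B = A/(x)` is a cyclic `A`-module; the argument works for any ring `A`
of characteristic `p` and any `x` which is not a multiple of `x^p`. The module `Γ^p_A(B)` is
generated by `γ^p(1)` (`exists_smul_gamma`), because products of divided powers of multiples of `1`
are multiples of `γ^p(1)`, and `T^p_A(B)` is generated by `1 ⊗ ⋯ ⊗ 1` (`exists_smul_tprod`).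
It remains to find the annihilators of these generators.

In the tensor power a scalar can be moved into one factor, so `x` kills `1 ⊗ ⋯ ⊗ 1`, and
multiplication `T^p_A(B) → B` is an isomorphism; it restricts to one on the symmetric tensors.

In `Γ^p_A(B)` the homogeneity of `γ^p` gives `x^p γ^p(1) = γ^p(x · 1) = 0`. That no smaller power
of `x` kills `γ^p(1)` is the point where the characteristic enters: the Frobenius of `A` induces
an additive map `φ : B → A/(x^p)` with `φ(ab) = a^p φ(b)` (`quotientFrobenius`), and every such
map `φ` extends to a linear map `Γ^p_A(B) → A/(x^p)` which sends `γ^p(b)` to `φ(b)`, hence `γ^p(1)`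
to `1` (`frobeniusLift`). The extension is built in the square-zero extension of `A/(x^p)`:
there `γ^p` may be sent to `φ` and `γ^j` to `0` for all other `j > 0`, since the binomial
coefficients `p.choose j` with `0 < j < p` vanish in characteristic `p`.

Hence `x γ^p(1)` is nonzero, whereas its image in the symmetric tensors, which `x` annihilates,
is zero.
-/

open scoped Polynomial

/-! ### Tensor powers of a cyclic algebra -/

section TensorPower

variable {A B : Type*} [CommRing A] [CommRing B] [Algebra A B]

theorem exists_smul_tprod {ι : Type*} [Fintype ι]
    (hs : Function.Surjective (algebraMap A B)) (t : ⨂[A] (_ : ι), B) :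
    ∃ a : A, t = a • PiTensorProduct.tprod A fun _ => (1 : B) := by
  induction t using PiTensorProduct.induction_on with
  | smul_tprod r f =>
    choose a ha using fun i => hs (f i)
    refine ⟨r * ∏ i, a i, ?_⟩
    rw [mul_smul, ← MultilinearMap.map_smul_univ]
    simp only [← Algebra.algebraMap_eq_smul_one, ha]
  | add t u ht hu =>
    obtain ⟨a, rfl⟩ := ht
    obtain ⟨b, rfl⟩ := hu
    exact ⟨a + b, (add_smul _ _ _).symm⟩

theorem smul_tprod_one_eq_zero {ι : Type*} [Nonempty ι] {a : A} (ha : algebraMap A B a = 0) :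
    (a • PiTensorProduct.tprod A fun _ : ι => (1 : B)) = 0 := by
  classical
  obtain ⟨i⟩ := ‹Nonempty ι›
  have h := (PiTensorProduct.tprod A).map_update_smul (fun _ : ι => (1 : B)) i a 1
  rw [Function.update_eq_self_iff.2 rfl] at h
  rw [← h, ← Algebra.algebraMap_eq_smul_one, ha]
  exact MultilinearMap.map_coord_zero _ i (Function.update_self _ _ _)

/-- Multiplication of the factors, as a map from the tensor power of an algebra to the algebra. -/
noncomputable def tensorPowerMul (A B ι : Type*) [CommRing A] [CommRing B] [Algebra A B]
    [Fintype ι] : (⨂[A] (_ : ι), B) →ₗ[A] B :=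
  PiTensorProduct.lift (MultilinearMap.mkPiAlgebra A ι B)

theorem tensorPowerMul_tprod_one {ι : Type*} [Fintype ι] :
    tensorPowerMul A B ι (PiTensorProduct.tprod A fun _ => 1) = 1 := by
  simp [tensorPowerMul]

theorem tensorPowerMul_injective {ι : Type*} [Fintype ι] [Nonempty ι]
    (hs : Function.Surjective (algebraMap A B)) :
    Function.Injective (tensorPowerMul A B ι) := by
  refine (injective_iff_map_eq_zero _).2 fun t ht => ?_
  obtain ⟨a, rfl⟩ := exists_smul_tprod hs t
  rw [map_smul, tensorPowerMul_tprod_one, ← Algebra.algebraMap_eq_smul_one] at ht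
  exact smul_tprod_one_eq_zero ht

theorem exists_tensorPower_equiv {ι : Type*} [Fintype ι] [Nonempty ι]
    (hs : Function.Surjective (algebraMap A B)) :
    ∃ e : (⨂[A] (_ : ι), B) ≃ₗ[A] B, e (PiTensorProduct.tprod A fun _ => 1) = 1 := by
  refine ⟨LinearEquiv.ofBijective (tensorPowerMul A B ι)
    ⟨tensorPowerMul_injective hs, fun b => ?_⟩, tensorPowerMul_tprod_one⟩
  obtain ⟨a, rfl⟩ := hs b
  exact ⟨a • PiTensorProduct.tprod A fun _ => 1, by
    rw [map_smul, tensorPowerMul_tprod_one, Algebra.algebraMap_eq_smul_one]⟩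

theorem exists_symmetricTensors_equiv {n : ℕ} [NeZero n]
    (hs : Function.Surjective (algebraMap A B)) :
    ∃ e : symmetricTensors A B n ≃ₗ[A] B, e (symmetricTensors.pow A n 1) = 1 := by
  have h1 : (tensorPowerMul A B (Fin n) ∘ₗ (symmetricTensors A B n).subtype)
      (symmetricTensors.pow A n 1) = 1 := tensorPowerMul_tprod_one
  refine ⟨LinearEquiv.ofBijective
    (tensorPowerMul A B (Fin n) ∘ₗ (symmetricTensors A B n).subtype)
    ⟨(tensorPowerMul_injective hs).comp Subtype.val_injective, fun b => ?_⟩, h1⟩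
  obtain ⟨a, rfl⟩ := hs b
  exact ⟨a • symmetricTensors.pow A n 1, by
    rw [map_smul, h1, Algebra.algebraMap_eq_smul_one]⟩

end TensorPower

/-! ### Divided powers of a cyclic algebra -/

section DividedPower

variable {A B : Type*} [CommRing A] [CommRing B] [Algebra A B]

theorem exists_smul_gamma (hs : Function.Surjective (algebraMap A B)) (n : ℕ)
    (y : dividedPower A B n) : ∃ a : A, y = a • dividedPower.gamma A n (1 : B) := by
  suffices h : dividedPower A B n ≤ Submodule.span A {DividedPowerAlgebra.dp A n (1 : B)} by
    obtain ⟨a, ha⟩ := Submodule.mem_span_singleton.1 (h y.2)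
    exact ⟨a, Subtype.ext ha.symm⟩
  refine Submodule.span_le.2 ?_
  rintro _ ⟨r, ν, x, hν, rfl⟩
  choose a ha using fun j => hs (x j)
  refine Submodule.mem_span_singleton.2
    ⟨(∏ j, a j ^ ν j) * (Nat.multinomial Finset.univ ν : A), ?_⟩
  simp only [← ha, Algebra.algebraMap_eq_smul_one, DividedPowerAlgebra.dp_smul]
  simp only [Algebra.smul_def, Finset.prod_mul_distrib, DividedPowerAlgebra.prod_dp, hν, map_mul,
    map_prod, map_natCast, mul_assoc]

theorem pow_smul_gamma_one {n : ℕ} (hn : n ≠ 0) {a : A} (ha : algebraMap A B a = 0) :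
    a ^ n • dividedPower.gamma A n (1 : B) = 0 := by
  refine Subtype.ext ?_
  change a ^ n • DividedPowerAlgebra.dp A n (1 : B) = 0
  rw [← DividedPowerAlgebra.dp_smul, ← Algebra.algebraMap_eq_smul_one, ha,
    DividedPowerAlgebra.dp_null_of_ne_zero hn]

end DividedPower

/-! ### Frobenius-semilinear maps as functionals on divided powers -/

section Frobenius

variable {A M C : Type*} [CommRing A] [AddCommGroup M] [Module A M] [CommRing C] [Algebra A C]

/-- The divided power system on `M` with values in the dual numbers over `C`: the `p`-th divided
power is the infinitesimal element `φ m`, all other ones of positive degree vanish. -/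
noncomputable def frobeniusDp (p : ℕ) (φ : M →+ C) (q : ℕ × M) : TrivSqZeroExt C C :=
  if q.1 = 0 then 1 else if q.1 = p then TrivSqZeroExt.inr (φ q.2) else 0

theorem frobeniusDp_zero (p : ℕ) (φ : M →+ C) (m : M) : frobeniusDp p φ (0, m) = 1 :=
  if_pos rfl

theorem frobeniusDp_mul {p : ℕ} (hp : p.Prime) (hC : (p : C) = 0) (φ : M →+ C) (j l : ℕ) (m : M) :
    frobeniusDp p φ (j, m) * frobeniusDp p φ (l, m) =
      (j + l).choose j • frobeniusDp p φ (j + l, m) := by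
  rcases eq_or_ne j 0 with rfl | hj
  · simp [frobeniusDp]
  rcases eq_or_ne l 0 with rfl | hl
  · simp [frobeniusDp]
  have h0 : frobeniusDp p φ (j, m) * frobeniusDp p φ (l, m) = 0 := by
    simp only [frobeniusDp, hj, hl, if_false]
    split_ifs <;> simp
  rw [h0]
  by_cases hjl : j + l = p
  · have hc : (((j + l).choose j : ℕ) : C) = 0 := by
      obtain ⟨c, hc⟩ := hp.dvd_choose_self (k := j) hj (by omega)
      rw [hjl, hc, Nat.cast_mul, hC, zero_mul]
    rw [frobeniusDp, if_neg (by omega), if_pos hjl, ← TrivSqZeroExt.inr_smul, nsmul_eq_mul, hc,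
      zero_mul, TrivSqZeroExt.inr_zero]
  · rw [frobeniusDp, if_neg (by omega), if_neg hjl, smul_zero]

theorem frobeniusDp_add (p : ℕ) (φ : M →+ C) (n : ℕ) (u v : M) :
    frobeniusDp p φ (n, u + v) = ∑ q ∈ Finset.HasAntidiagonal.antidiagonal n,
      frobeniusDp p φ (q.1, u) * frobeniusDp p φ (q.2, v) := by
  rcases eq_or_ne n 0 with rfl | hn
  · simp [frobeniusDp]
  -- Only the two extreme terms survive: in the others both factors are zero or infinitesimal.
  rw [Finset.sum_eq_add_of_mem (0, n) (n, 0) (by simp) (by simp) (by simp [hn.symm])]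
  · simp only [frobeniusDp, hn, if_false, if_true, one_mul, mul_one]
    split_ifs
    · rw [map_add, TrivSqZeroExt.inr_add, add_comm]
    · simp
  · rintro ⟨j, l⟩ hq ⟨h1, h2⟩
    have hq : j + l = n := by simpa using hq
    have hj : j ≠ 0 := by rintro rfl; exact h1 (by simp_all)
    have hl : l ≠ 0 := by rintro rfl; exact h2 (by simp_all)
    simp only [frobeniusDp, hj, hl, if_false]
    split_ifs <;> simp

theorem frobeniusDp_smul {p : ℕ} (φ : M →+ C) (hφ : ∀ (a : A) (m : M), φ (a • m) = a ^ p • φ m)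
    (n : ℕ) (a : A) (m : M) : frobeniusDp p φ (n, a • m) = a ^ n • frobeniusDp p φ (n, m) := by
  simp only [frobeniusDp]
  split_ifs with h0 h
  · simp [h0]
  · rw [hφ, TrivSqZeroExt.inr_smul, h]
  · simp

/-- The algebra homomorphism from `Γ_A(M)` to the dual numbers over `C` which corresponds to the
divided power system `frobeniusDp`. -/
noncomputable def frobeniusAlgHom {p : ℕ} (hp : p.Prime) (hC : (p : C) = 0) (φ : M →+ C)
    (hφ : ∀ (a : A) (m : M), φ (a • m) = a ^ p • φ m) :
    DividedPowerAlgebra A M →ₐ[A] TrivSqZeroExt C C :=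
  DividedPowerAlgebra.lift' (f := frobeniusDp p φ) (frobeniusDp_zero p φ) (frobeniusDp_smul φ hφ)
    (frobeniusDp_mul hp hC φ) (frobeniusDp_add p φ)

theorem frobeniusAlgHom_dp {p : ℕ} (hp : p.Prime) (hC : (p : C) = 0) (φ : M →+ C)
    (hφ : ∀ (a : A) (m : M), φ (a • m) = a ^ p • φ m) (n : ℕ) (m : M) :
    frobeniusAlgHom hp hC φ hφ (DividedPowerAlgebra.dp A n m) = frobeniusDp p φ (n, m) :=
  DividedPowerAlgebra.lift'_apply_dp (frobeniusDp_zero p φ) (frobeniusDp_smul φ hφ)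
    (frobeniusDp_mul hp hC φ) (frobeniusDp_add p φ) n m

/-- The linear map `Γ^p_A(M) → C` which extends an additive map `φ : M → C` with
`φ (a m) = a ^ p φ m`, in characteristic `p`. -/
noncomputable def frobeniusLift {p : ℕ} (hp : p.Prime) (hC : (p : C) = 0) (φ : M →+ C)
    (hφ : ∀ (a : A) (m : M), φ (a • m) = a ^ p • φ m) : dividedPower A M p →ₗ[A] C :=
  (TrivSqZeroExt.sndHom C C).restrictScalars A ∘ₗ (frobeniusAlgHom hp hC φ hφ).toLinearMap ∘ₗ
    (dividedPower A M p).subtype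

theorem frobeniusLift_gamma {p : ℕ} (hp : p.Prime) (hC : (p : C) = 0) (φ : M →+ C)
    (hφ : ∀ (a : A) (m : M), φ (a • m) = a ^ p • φ m) (m : M) :
    frobeniusLift hp hC φ hφ (dividedPower.gamma A p m) = φ m := by
  change (frobeniusAlgHom hp hC φ hφ (DividedPowerAlgebra.dp A p m)).snd = φ m
  rw [frobeniusAlgHom_dp, frobeniusDp, if_neg hp.ne_zero, if_pos rfl, TrivSqZeroExt.snd_inr]

end Frobenius

/-! ### The quotient by a principal ideal in characteristic `p` -/

section PrincipalQuotient

variable {A B : Type*} [CommRing A] [CommRing B] [Algebra A B] {p : ℕ} [Fact p.Prime] [CharP A p]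
  {x : A}

/-- The Frobenius of `A`, as a ring homomorphism from the quotient `B = A / (x)` to
`A / (x ^ p)`. -/
noncomputable def quotientFrobenius (p : ℕ) [Fact p.Prime] [CharP A p] (x : A)
    (hs : Function.Surjective (algebraMap A B))
    (hx : RingHom.ker (algebraMap A B) = Ideal.span {x}) :
    B →+* A ⧸ Ideal.span {x ^ p} :=
  (algebraMap A B).liftOfSurjective hs
    ⟨(Ideal.Quotient.mk (Ideal.span {x ^ p})).comp (frobenius A p), by
      rw [hx, Ideal.span_singleton_le_iff_mem, RingHom.mem_ker, RingHom.comp_apply, frobenius_def]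
      exact Ideal.Quotient.eq_zero_iff_mem.2 (Ideal.mem_span_singleton_self _)⟩

theorem quotientFrobenius_algebraMap (hs : Function.Surjective (algebraMap A B))
    (hx : RingHom.ker (algebraMap A B) = Ideal.span {x}) (a : A) :
    quotientFrobenius p x hs hx (algebraMap A B a) = Ideal.Quotient.mk _ (a ^ p) :=
  RingHom.liftOfRightInverse_comp_apply _ _ _ _ a

theorem quotientFrobenius_smul (hs : Function.Surjective (algebraMap A B))
    (hx : RingHom.ker (algebraMap A B) = Ideal.span {x}) (a : A) (b : B) :
    quotientFrobenius p x hs hx (a • b) = a ^ p • quotientFrobenius p x hs hx b := by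
  rw [Algebra.smul_def, map_mul, quotientFrobenius_algebraMap, Algebra.smul_def,
    Ideal.Quotient.algebraMap_eq]

theorem exists_dividedPower_equiv (hs : Function.Surjective (algebraMap A B))
    (hx : RingHom.ker (algebraMap A B) = Ideal.span {x}) :
    ∃ e : dividedPower A B p ≃ₗ[A] A ⧸ Ideal.span {x ^ p},
      e (dividedPower.gamma A p (1 : B)) = 1 := by
  have hp := (Fact.out : p.Prime)
  have hC : (p : A ⧸ Ideal.span {x ^ p}) = 0 := by
    rw [← map_natCast (Ideal.Quotient.mk (Ideal.span {x ^ p})), CharP.cast_eq_zero, map_zero]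
  have hx0 : algebraMap A B x = 0 := by
    rw [← RingHom.mem_ker, hx]
    exact Ideal.mem_span_singleton_self x
  let L : dividedPower A B p →ₗ[A] A ⧸ Ideal.span {x ^ p} :=
    frobeniusLift hp hC (quotientFrobenius p x hs hx).toAddMonoidHom
      (quotientFrobenius_smul hs hx)
  have hL : L (dividedPower.gamma A p (1 : B)) = 1 :=
    (frobeniusLift_gamma hp hC _ _ _).trans (map_one (quotientFrobenius p x hs hx))
  have hL' (a : A) : L (a • dividedPower.gamma A p (1 : B)) = Ideal.Quotient.mk _ a := by
    rw [map_smul, hL, ← Algebra.algebraMap_eq_smul_one, Ideal.Quotient.algebraMap_eq]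
  refine ⟨LinearEquiv.ofBijective L ⟨(injective_iff_map_eq_zero _).2 fun y hy => ?_, fun z => ?_⟩,
    hL⟩
  · obtain ⟨a, rfl⟩ := exists_smul_gamma hs p y
    rw [hL', Ideal.Quotient.eq_zero_iff_mem, Ideal.mem_span_singleton] at hy
    obtain ⟨c, rfl⟩ := hy
    rw [mul_comm, mul_smul, pow_smul_gamma_one hp.ne_zero hx0, smul_zero]
  · obtain ⟨a, rfl⟩ := Ideal.Quotient.mk_surjective z
    exact ⟨_, hL' a⟩

/-- The canonical map is not injective as soon as `x` is not a multiple of `x ^ p`: it kills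
`x • γ^p(1)`. -/
theorem canonicalMap_not_injective (hs : Function.Surjective (algebraMap A B))
    (hx : RingHom.ker (algebraMap A B) = Ideal.span {x}) (hxp : ¬ x ^ p ∣ x) :
    ¬ Function.Injective (GammaToTS.canonicalMap A B p) := by
  have : NeZero p := ⟨(Fact.out : p.Prime).ne_zero⟩
  intro hinj
  obtain ⟨e, he⟩ := exists_dividedPower_equiv (p := p) hs hx
  obtain ⟨e', -⟩ := exists_symmetricTensors_equiv (n := p) hs
  have hx0 : algebraMap A B x = 0 := by
    rw [← RingHom.mem_ker, hx]
    exact Ideal.mem_span_singleton_self x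
  have h : x • dividedPower.gamma A p (1 : B) = 0 := by
    refine hinj (e'.injective ?_)
    rw [map_smul, map_smul, Algebra.smul_def, hx0, zero_mul, map_zero, map_zero]
  apply hxp
  rw [← Ideal.mem_span_singleton, ← Ideal.Quotient.eq_zero_iff_mem,
    ← Ideal.Quotient.algebraMap_eq, Algebra.algebraMap_eq_smul_one, ← he, ← map_smul, h, map_zero]

end PrincipalQuotient

theorem mainTheorem2 (k : Type*) [Field k] (p : ℕ) [Fact p.Prime] [CharP k p] :
    letI : Algebra (Polynomial k) k := (Polynomial.evalRingHom (0 : k)).toAlgebra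
    (∃ e : dividedPower (Polynomial k) k p ≃ₗ[Polynomial k]
          Polynomial k ⧸ Ideal.span {(Polynomial.X : Polynomial k) ^ p},
        e (dividedPower.gamma (Polynomial k) p (1 : k)) = 1) ∧
      (∃ e : (⨂[Polynomial k] (_ : Fin p), k) ≃ₗ[Polynomial k] k,
        e (PiTensorProduct.tprod (Polynomial k) fun _ => (1 : k)) = 1) ∧
      (∃ e : symmetricTensors (Polynomial k) k p ≃ₗ[Polynomial k] k,
        e (symmetricTensors.pow (Polynomial k) p (1 : k)) = 1) ∧
      ¬ Function.Injective (GammaToTS.canonicalMap (Polynomial k) k p) := by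
  let : Algebra k[X] k := (Polynomial.evalRingHom (0 : k)).toAlgebra
  have hp := (Fact.out : p.Prime)
  have : NeZero p := ⟨hp.ne_zero⟩
  have hs : Function.Surjective (algebraMap k[X] k) := fun b => ⟨Polynomial.C b, Polynomial.eval_C⟩
  have hx : RingHom.ker (algebraMap k[X] k) = Ideal.span {Polynomial.X} := by
    ext f
    rw [RingHom.mem_ker, Ideal.mem_span_singleton, Polynomial.X_dvd_iff,
      Polynomial.coeff_zero_eq_eval_zero]
    rfl
  have hxp : ¬ (Polynomial.X : k[X]) ^ p ∣ Polynomial.X := fun h => by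
    simpa using Polynomial.X_pow_dvd_iff.1 h 1 hp.one_lt
  exact ⟨exists_dividedPower_equiv hs hx, exists_tensorPower_equiv hs,
    exists_symmetricTensors_equiv hs, canonicalMap_not_injective hs hx hxp⟩
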